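/- Let $x_1,\dots,x_n\in\mathbb{R}$ be not all equal, $\bar x=\frac1n\sum_{i=1}^n x_i$, let $\sigma>0$ be known and let $\boldsymbol{\beta_0}=(\beta_{1},\beta_{2})^{\intercal}\in\mathbb{R}^2$. Let $Y_1,\dots,Y_n$ be independent random variables with $Y_i\sim{\rm N}(\beta_1+\beta_2(x_i-\bar x),\sigma^2)$. Let $f_i(\cdot\,|\boldsymbol\beta)$ denote the density of the $i$-th response under the parameter $\boldsymbol\beta\in\mathbb{R}^2$, and let $$\bar I_n(\boldsymbol\beta)=\frac1n\sum_{i=1}^n\left(-{\rm E}_{\boldsymbol\beta}\left[\frac{\partial^2}{\partial\beta_k\partial\beta_l}\log f_i(Y_i|\boldsymbol\beta)\right]\right)_{k,l=1,2}$$ be the average Fisher information matrix, where ${\rm E}_{\boldsymbol\beta}$ is expectation when the true parameter is $\boldsymbol\beta$. The maximum likelihood estimator of $\boldsymbol{\beta_0}$, i.e. the maximiser $\boldsymbol{\hat\beta}$ over $\boldsymbol\beta\in\mathbb{R}^2$ of $\prod_{i=1}^n f_i(Y_i|\boldsymbol\beta)$, exists, is unique, and equals $$\boldsymbol{\hat\beta}=\left(\bar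 Y,\ \frac{\sum_{i=1}^n(x_i-\bar x)Y_i}{\sum_{i=1}^n(x_i-\bar x)^2}\right)^{\intercal},\qquad \bar Y=\frac1n\sum_{i=1}^nY_i .$$ Let $\boldsymbol Z\sim{\rm N}_2(\boldsymbol 0,I_{2\times2})$ and let $h:\mathbb{R}^2\to\mathbb{R}$ be three times differentiable with bounded derivatives of orders one, two and three. Write $\|h\|_2=\sup_{i,j}\sup_{x}\left|\frac{\partial^2 h}{\partial x_i\partial x_j}(x)\right|$ and $\|h\|_3=\sup_{i,j,k}\sup_x\left|\frac{\partial^3 h}{\partial x_i\partial x_j\partial x_k}(x)\right|$. Then the expectations below exist and are finite, and, with $[\cdot]^{1/2}$ denoting the positive semidefinite square root, $$\left|{\rm E}\left[h\left(\sqrt n\,[\bar I_n(\boldsymbol{\beta_0})]^{1/2}(\boldsymbol{\hat\beta}-\boldsymbol{\beta_0})\right)\right]-{\rm E}[h(\boldsymbol Z)]\right|\le\frac{\|h\|_2}{4}\left(\sqrt{\frac2n}+\frac{\sqrt{2\sum_{i=1}^n(x_i-\bar x)^4}}{\sum_{i=1}^n(x_i-\bar x)^2}\right)+\frac{\|h\|_2}{\sqrt{2n}}+\frac{8\|h\|_3}{3\sqrt\pi}\left(\frac1{\sqrt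 n}+\frac{\sum_{i=1}^n|x_i-\bar x|^3}{\left[\sum_{i=1}^n(x_i-\bar x)^2\right]^{3/2}}\right).$$ -/

import Mathlib

open MeasureTheory ProbabilityTheory
open scoped BigOperators NNReal MatrixOrder

noncomputable section

namespace SimpleLinear

/-! ### Test functions -/

/-- The partial derivative `∂f/∂x_i`. -/
def partialDeriv {d : ℕ} (i : Fin d) (f : EuclideanSpace ℝ (Fin d) → ℝ) :
    EuclideanSpace ℝ (Fin d) → ℝ :=
  fun x => lineDeriv ℝ f x (EuclideanSpace.single i (1 : ℝ))

/-- The class `H`: the function is three times (Fréchet) differentiable, and its derivatives of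
orders one, two and three are bounded. The function itself need not be bounded. (In finite
dimension, the derivative of `f` is differentiable iff all partial derivatives of `f` are.) -/
structure IsTestFunction {d : ℕ} (h : EuclideanSpace ℝ (Fin d) → ℝ) : Prop where
  differentiable₁ : Differentiable ℝ h
  differentiable₂ : ∀ i, Differentiable ℝ (partialDeriv i h)
  differentiable₃ : ∀ i j, Differentiable ℝ (partialDeriv i (partialDeriv j h))
  bounded₁ : ∃ C : ℝ, ∀ i x, |partialDeriv i h x| ≤ C
  bounded₂ : ∃ C : ℝ, ∀ i j x, |partialDeriv i (partialDeriv j h) x| ≤ C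
  bounded₃ : ∃ C : ℝ, ∀ i j k x, |partialDeriv i (partialDeriv j (partialDeriv k h)) x| ≤ C

/-- `‖h‖₂ = sup_{i,j} sup_x |∂²h/∂x_i∂x_j (x)|`. -/
def derivNorm₂ {d : ℕ} (h : EuclideanSpace ℝ (Fin d) → ℝ) : ℝ :=
  ⨆ i : Fin d, ⨆ j : Fin d, ⨆ x, |partialDeriv i (partialDeriv j h) x|

/-- `‖h‖₃ = sup_{i,j,k} sup_x |∂³h/∂x_i∂x_j∂x_k (x)|`. -/
def derivNorm₃ {d : ℕ} (h : EuclideanSpace ℝ (Fin d) → ℝ) : ℝ :=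
  ⨆ i : Fin d, ⨆ j : Fin d, ⨆ k : Fin d,
    ⨆ x, |partialDeriv i (partialDeriv j (partialDeriv k h)) x|

/-! ### The straight-line regression model -/

/-- The mean `x̄` of the covariates. -/
def mean {n : ℕ} (x : Fin n → ℝ) : ℝ := (∑ i, x i) / n

/-- The regression function `β₁ + β₂ (x_i - x̄)`; the parameters `β₁`, `β₂` are the coordinates
`β 0`, `β 1`. -/
def line {n : ℕ} (x : Fin n → ℝ) (β : EuclideanSpace ℝ (Fin 2)) (i : Fin n) : ℝ :=
  β 0 + β 1 * (x i - mean x)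

/-- The law `N(β₁ + β₂ (x_i - x̄), σ²)` of the `i`-th response. -/
def responseLaw {n : ℕ} (x : Fin n → ℝ) (σ : ℝ) (β : EuclideanSpace ℝ (Fin 2)) (i : Fin n) :
    Measure ℝ :=
  gaussianReal (line x β i) (σ ^ 2).toNNReal

/-- The probability density function `f_i(y | β)` of the `i`-th response. -/
def density {n : ℕ} (x : Fin n → ℝ) (σ : ℝ) (i : Fin n) (β : EuclideanSpace ℝ (Fin 2))
    (y : ℝ) : ℝ :=
  gaussianPDFReal (line x β i) (σ ^ 2).toNNReal y

/-- The likelihood function `L(β; y) = ∏ f_i(y_i | β)`. -/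
def likelihood {n : ℕ} (x : Fin n → ℝ) (σ : ℝ) (β : EuclideanSpace ℝ (Fin 2))
    (y : Fin n → ℝ) : ℝ :=
  ∏ i, density x σ i β (y i)

/-- `b` is a maximum likelihood estimate of `β` for the observations `y`. -/
def IsMLE {n : ℕ} (x : Fin n → ℝ) (σ : ℝ) (y : Fin n → ℝ) (b : EuclideanSpace ℝ (Fin 2)) :
    Prop :=
  ∀ β, likelihood x σ β y ≤ likelihood x σ b y

/-- The Hessian matrix `J_i(y, β)` of `β ↦ log f_i(y | β)`. -/
def logDensityHessian {n : ℕ} (x : Fin n → ℝ) (σ : ℝ) (i : Fin n) (y : ℝ)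
    (β : EuclideanSpace ℝ (Fin 2)) : Matrix (Fin 2) (Fin 2) ℝ :=
  Matrix.of fun k l => partialDeriv k (partialDeriv l fun b => Real.log (density x σ i b y)) β

/-- The Fisher information matrix `I_i(β) = -E[J_i(Y_i, β)]` of the `i`-th response. -/
def fisherInfo {n : ℕ} (x : Fin n → ℝ) (σ : ℝ) (i : Fin n) (β : EuclideanSpace ℝ (Fin 2)) :
    Matrix (Fin 2) (Fin 2) ℝ :=
  Matrix.of fun k l => -∫ y, logDensityHessian x σ i y β k l ∂(responseLaw x σ β i)

/-- The average Fisher information matrix `Ī_n(β) = (1/n) ∑ I_i(β)`. -/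
def avgFisherInfo {n : ℕ} (x : Fin n → ℝ) (σ : ℝ) (β : EuclideanSpace ℝ (Fin 2)) :
    Matrix (Fin 2) (Fin 2) ℝ :=
  (n : ℝ)⁻¹ • ∑ i, fisherInfo x σ i β

/-- The normalized estimator `√n [Ī_n(β₀)]^{1/2} (b - β₀)`, where the square root is the positive
semidefinite square root of a matrix. -/
def normalized {n : ℕ} (x : Fin n → ℝ) (σ : ℝ) (β₀ b : EuclideanSpace ℝ (Fin 2)) :
    EuclideanSpace ℝ (Fin 2) :=
  √(n : ℝ) • Matrix.toEuclideanLin (CFC.sqrt (avgFisherInfo x σ β₀)) (b - β₀)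

end SimpleLinear

end

open SimpleLinear

namespace SimpleLinear

variable {n : ℕ}

/-! ### Partial derivatives of test functions -/

/-! The left-hand side of the bound is exactly zero. The model is Gaussian and linear in `β`, so the
maximum likelihood estimator is least squares, a linear function of the responses (`isMLE_iff`). The
log-density is quadratic in `β`, so its Hessian is constant, and centring the covariates makes the
information matrix diagonal (`avgFisherInfo_eq`). Its square root turns the estimation error into a
combination of standard normal errors whose coefficients form two orthonormal vectors of `ℝⁿ`
(`normalized_leastSquares`, `sum_sq_inner_errorCoeff`). Hence the normalized estimator has the law
of `Z` for every `n`, and the two expectations agree. What remains is integrability of `h` and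
nonnegativity of the right-hand side. -/

lemma partialDeriv_eq_fderiv {d : ℕ} {f : EuclideanSpace ℝ (Fin d) → ℝ}
    {z : EuclideanSpace ℝ (Fin d)} (hf : DifferentiableAt ℝ f z) (i : Fin d) :
    partialDeriv i f z = fderiv ℝ f z (EuclideanSpace.single i 1) :=
  hf.lineDeriv_eq_fderiv

lemma abs_fderiv_le_of_abs_partialDeriv_le {d : ℕ} {f : EuclideanSpace ℝ (Fin d) → ℝ}
    {z : EuclideanSpace ℝ (Fin d)} (hf : DifferentiableAt ℝ f z) {C : ℝ}
    (hC : ∀ i, |partialDeriv i f z| ≤ C) : ‖fderiv ℝ f z‖ ≤ d * |C| := by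
  refine ContinuousLinearMap.opNorm_le_bound _ (by positivity) fun v => ?_
  have hv : v = ∑ i, v i • EuclideanSpace.single i (1 : ℝ) := by
    ext j
    simp [Finset.sum_apply, Pi.single_apply]
  calc ‖fderiv ℝ f z v‖ = ‖∑ i, v i * partialDeriv i f z‖ := by
        conv_lhs => rw [hv]
        simp [partialDeriv_eq_fderiv hf]
    _ ≤ ∑ i, ‖v i * partialDeriv i f z‖ := norm_sum_le _ _
    _ ≤ ∑ _i : Fin d, ‖v‖ * |C| := by
        refine Finset.sum_le_sum fun i _ => ?_
        rw [norm_mul]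
        exact mul_le_mul (PiLp.norm_apply_le v i) ((hC i).trans (le_abs_self C))
          (norm_nonneg _) (norm_nonneg _)
    _ = d * |C| * ‖v‖ := by simp; ring

/-- Bounded first derivatives make `h` Lipschitz, so it grows at most linearly, and a Gaussian
measure has a finite first moment. -/
lemma IsTestFunction.integrable {d : ℕ} {h : EuclideanSpace ℝ (Fin d) → ℝ}
    (hh : IsTestFunction h) (μ : Measure (EuclideanSpace ℝ (Fin d))) [IsGaussian μ] :
    Integrable h μ := by
  obtain ⟨C, hC⟩ := hh.bounded₁
  have hlip (z) : ‖h z - h 0‖ ≤ d * |C| * ‖z - 0‖ :=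
    convex_univ.norm_image_sub_le_of_norm_fderiv_le (fun z _ => hh.differentiable₁ z)
      (fun z _ => abs_fderiv_le_of_abs_partialDeriv_le (hh.differentiable₁ z) fun i => hC i z)
      (Set.mem_univ _) (Set.mem_univ _)
  have hid : Integrable (fun z : EuclideanSpace ℝ (Fin d) => z) μ := IsGaussian.integrable_id
  refine ((integrable_const ‖h 0‖).add (hid.norm.const_mul (d * |C|))).mono'
    hh.differentiable₁.continuous.aestronglyMeasurable (ae_of_all _ fun z => ?_)
  have := norm_le_norm_add_norm_sub' (h z) (h 0)
  have := hlip z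
  simp only [sub_zero, Pi.add_apply] at *
  linarith

/-- No boundedness is needed: an unbounded real supremum takes the default value 0. -/
lemma derivNorm₂_nonneg {d : ℕ} (h : EuclideanSpace ℝ (Fin d) → ℝ) : 0 ≤ derivNorm₂ h :=
  Real.iSup_nonneg fun _ => Real.iSup_nonneg fun _ => Real.iSup_nonneg fun _ => abs_nonneg _

lemma derivNorm₃_nonneg {d : ℕ} (h : EuclideanSpace ℝ (Fin d) → ℝ) : 0 ≤ derivNorm₃ h :=
  Real.iSup_nonneg fun _ => Real.iSup_nonneg fun _ => Real.iSup_nonneg fun _ =>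
    Real.iSup_nonneg fun _ => abs_nonneg _

/-! ### Sums of independent standard normal variables with vector coefficients -/

/-- By independence the characteristic function at `t` is a product of factors `exp(-⟨a i, t⟩²/2)`.
The Parseval condition `ha` adds the exponents up to `-‖t‖²/2`. -/
lemma hasLaw_stdGaussian_sum_smul {Ω ι E : Type*} [Fintype ι] [MeasurableSpace Ω]
    {P : Measure Ω} [IsProbabilityMeasure P] [NormedAddCommGroup E] [InnerProductSpace ℝ E]
    [FiniteDimensional ℝ E] [MeasurableSpace E] [BorelSpace E]
    {X : ι → Ω → ℝ} (hX : ∀ i, HasLaw (X i) (gaussianReal 0 1) P) (hX_indep : iIndepFun X P)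
    {a : ι → E} (ha : ∀ t, ∑ i, inner ℝ (a i) t ^ 2 = ‖t‖ ^ 2) :
    HasLaw (fun ω => ∑ i, X i ω • a i) (stdGaussian E) P := by
  have hm (i : ι) : AEMeasurable (fun ω => X i ω • a i) P := (hX i).aemeasurable.smul_const _
  refine ⟨Finset.aemeasurable_fun_sum _ fun i _ => hm i, ?_⟩
  have : IsProbabilityMeasure (P.map fun ω => ∑ i, X i ω • a i) :=
    Measure.isProbabilityMeasure_map (Finset.aemeasurable_fun_sum _ fun i _ => hm i)
  refine Measure.ext_of_charFun (funext fun t => ?_)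
  have hind : iIndepFun (fun i ω => X i ω • a i) P :=
    hX_indep.comp (fun i r => r • a i) fun i => by fun_prop
  rw [hind.charFun_map_fun_sum_eq_prod hm, Finset.prod_apply]
  have hfac (i : ι) : charFun (P.map fun ω => X i ω • a i) t =
      Complex.exp ((-(inner ℝ (a i) t ^ 2) / 2 : ℝ)) := by
    have h1 : charFun (P.map fun ω => X i ω • a i) t =
        charFun (P.map (X i)) (inner ℝ (a i) t) := by
      rw [charFun_apply, charFun_apply_real, integral_map (hm i) (by fun_prop),
        integral_map (hX i).aemeasurable (by fun_prop)]
      refine integral_congr_ae (ae_of_all _ fun ω => ?_)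
      simp only [real_inner_smul_left]
      push_cast
      ring_nf
    rw [h1, (hX i).map_eq, charFun_gaussianReal]
    push_cast
    congr 1
    ring
  simp_rw [hfac]
  rw [← Complex.exp_sum, charFun_stdGaussian, ← Complex.ofReal_sum, ← Finset.sum_div,
    Finset.sum_neg_distrib, ha]
  push_cast
  rfl

/-! ### The design -/

lemma sum_sub_mean (x : Fin n → ℝ) : ∑ i, (x i - mean x) = 0 := by
  rcases Nat.eq_zero_or_pos n with rfl | hn
  · simp
  · have : (n : ℝ) ≠ 0 := by positivity
    simp [mean, mul_div_cancel₀, this]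

lemma sum_sq_sub_mean_pos {x : Fin n → ℝ} (hx : ∃ i j, x i ≠ x j) :
    0 < ∑ i, (x i - mean x) ^ 2 := by
  obtain ⟨i, j, hij⟩ := hx
  by_contra! hle
  have h0 := (Finset.sum_eq_zero_iff_of_nonneg fun k _ => sq_nonneg (x k - mean x)).1
    (le_antisymm hle (Finset.sum_nonneg fun k _ => sq_nonneg _))
  have hm (k : Fin n) : x k = mean x := by
    have := h0 k (Finset.mem_univ k)
    nlinarith
  exact hij ((hm i).trans (hm j).symm)

lemma coe_toNNReal_sq (σ : ℝ) : ((σ ^ 2).toNNReal : ℝ) = σ ^ 2 :=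
  Real.coe_toNNReal _ (sq_nonneg σ)

/-- The gradient `(1, x_i - x̄)` of the regression function. -/
noncomputable def regressor (x : Fin n → ℝ) (i : Fin n) : Fin 2 → ℝ := ![1, x i - mean x]

lemma line_add_smul_single (x : Fin n → ℝ) (β : EuclideanSpace ℝ (Fin 2)) (i : Fin n)
    (k : Fin 2) (t : ℝ) :
    line x (β + t • EuclideanSpace.single k 1) i = line x β i + t * regressor x i k := by
  fin_cases k <;> simp [line, regressor] <;> ring

/-! ### The Fisher information -/

lemma log_density {σ : ℝ} (hσ : 0 < σ) (x : Fin n → ℝ) (i : Fin n)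
    (β : EuclideanSpace ℝ (Fin 2)) (y : ℝ) :
    Real.log (density x σ i β y) =
      Real.log (√(2 * Real.pi * σ ^ 2))⁻¹ - (y - line x β i) ^ 2 / (2 * σ ^ 2) := by
  rw [density, gaussianPDFReal, coe_toNNReal_sq,
    Real.log_mul (by positivity) (Real.exp_ne_zero _), Real.log_exp]
  ring

lemma partialDeriv_log_density {σ : ℝ} (hσ : 0 < σ) (x : Fin n → ℝ) (i : Fin n) (l : Fin 2)
    (β : EuclideanSpace ℝ (Fin 2)) (y : ℝ) :
    partialDeriv l (fun b => Real.log (density x σ i b y)) β =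
      (y - line x β i) * regressor x i l / σ ^ 2 := by
  simp only [partialDeriv, lineDeriv, log_density hσ, line_add_smul_single]
  have h1 : HasDerivAt (fun t : ℝ => y - (line x β i + t * regressor x i l))
      (-(1 * regressor x i l)) 0 :=
    (((hasDerivAt_id' (0 : ℝ)).mul_const _).const_add _).const_sub _
  refine (((h1.fun_pow 2).div_const (2 * σ ^ 2)).const_sub _).deriv.trans ?_
  have : σ ≠ 0 := hσ.ne'
  simp
  field_simp

lemma logDensityHessian_apply {σ : ℝ} (hσ : 0 < σ) (x : Fin n → ℝ) (i : Fin n) (y : ℝ)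
    (β : EuclideanSpace ℝ (Fin 2)) (k l : Fin 2) :
    logDensityHessian x σ i y β k l = -(regressor x i k * regressor x i l / σ ^ 2) := by
  rw [logDensityHessian, Matrix.of_apply, funext fun b => partialDeriv_log_density hσ x i l b y]
  simp only [partialDeriv, lineDeriv, line_add_smul_single]
  have h1 : HasDerivAt (fun t : ℝ => y - (line x β i + t * regressor x i k))
      (-(1 * regressor x i k)) 0 :=
    (((hasDerivAt_id' (0 : ℝ)).mul_const _).const_add _).const_sub _
  rw [((h1.mul_const (regressor x i l)).div_const (σ ^ 2)).deriv]
  ring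

lemma fisherInfo_apply {σ : ℝ} (hσ : 0 < σ) (x : Fin n → ℝ) (i : Fin n)
    (β : EuclideanSpace ℝ (Fin 2)) (k l : Fin 2) :
    fisherInfo x σ i β k l = regressor x i k * regressor x i l / σ ^ 2 := by
  simp [fisherInfo, logDensityHessian_apply hσ, responseLaw]

/-- The off-diagonal entries are multiples of `∑ (x i - mean x)`, which vanishes. -/
lemma avgFisherInfo_eq {σ : ℝ} (hσ : 0 < σ) (hn : 0 < n) (x : Fin n → ℝ)
    (β : EuclideanSpace ℝ (Fin 2)) :
    avgFisherInfo x σ β =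
      Matrix.diagonal ![1 / σ ^ 2, (∑ i, (x i - mean x) ^ 2) / (n * σ ^ 2)] := by
  have hn' : (n : ℝ) ≠ 0 := by positivity
  have hσ' : σ ≠ 0 := hσ.ne'
  have h0 := sum_sub_mean x
  ext k l
  simp only [avgFisherInfo, Matrix.smul_apply, Matrix.sum_apply, fisherInfo_apply hσ,
    ← Finset.sum_div, smul_eq_mul]
  fin_cases k <;> fin_cases l
  · simp [regressor]
    field_simp
  · simp only [regressor, Fin.zero_eta, Fin.mk_one, Matrix.cons_val_zero, Matrix.cons_val_one,
      one_mul, h0]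
    simp
  · simp only [regressor, Fin.zero_eta, Fin.mk_one, Matrix.cons_val_zero, Matrix.cons_val_one,
      mul_one, h0]
    simp
  · simp [regressor, ← sq]
    field_simp

lemma sqrt_avgFisherInfo {σ : ℝ} (hσ : 0 < σ) (hn : 0 < n) (x : Fin n → ℝ)
    (β : EuclideanSpace ℝ (Fin 2)) :
    CFC.sqrt (avgFisherInfo x σ β) =
      Matrix.diagonal ![1 / σ, √(∑ i, (x i - mean x) ^ 2) / (√n * σ)] := by
  have hS : 0 ≤ ∑ i, (x i - mean x) ^ 2 := Finset.sum_nonneg fun i _ => sq_nonneg _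
  -- A positive semidefinite matrix with the right square is the square root.
  refine CFC.sqrt_unique ?_ ?_
  · rw [avgFisherInfo_eq hσ hn, Matrix.diagonal_mul_diagonal]
    congr 1
    ext k
    fin_cases k
    · simp [← sq]
    · simp only [Fin.mk_one, Matrix.cons_val_one, Matrix.cons_val_zero]
      rw [div_mul_div_comm, Real.mul_self_sqrt hS, mul_mul_mul_comm,
        Real.mul_self_sqrt n.cast_nonneg, sq]
  · rw [Matrix.nonneg_iff_posSemidef, Matrix.posSemidef_diagonal_iff]
    intro k
    fin_cases k
    · simp [hσ.le]
    · simp only [Fin.mk_one, Matrix.cons_val_one, Matrix.cons_val_zero]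
      positivity

/-! ### The maximum likelihood estimator -/

/-- The least squares estimate. -/
noncomputable def leastSquares (x y : Fin n → ℝ) : EuclideanSpace ℝ (Fin 2) :=
  !₂[(∑ i, y i) / n, (∑ i, (x i - mean x) * y i) / ∑ i, (x i - mean x) ^ 2]

/-- Pythagoras: the least squares residual is orthogonal to both regressors, and these are
orthogonal to each other by centring, so there is no cross term. -/
lemma sum_sq_sub_line {x : Fin n → ℝ} (hn : 0 < n) (hS : 0 < ∑ i, (x i - mean x) ^ 2)
    (y : Fin n → ℝ) (b : EuclideanSpace ℝ (Fin 2)) :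
    ∑ i, (y i - line x b i) ^ 2 = ∑ i, (y i - line x (leastSquares x y) i) ^ 2
      + (n * (b 0 - leastSquares x y 0) ^ 2
        + (∑ i, (x i - mean x) ^ 2) * (b 1 - leastSquares x y 1) ^ 2) := by
  have hn' : (n : ℝ) ≠ 0 := by positivity
  have h0 := sum_sub_mean x
  have e0 : ∑ i, y i = n * leastSquares x y 0 := by
    simp [leastSquares, mul_div_cancel₀, hn']
  have e1 : ∑ i, (x i - mean x) * y i = (∑ i, (x i - mean x) ^ 2) * leastSquares x y 1 := by
    simp [leastSquares, mul_div_cancel₀, hS.ne']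
  have key (c : EuclideanSpace ℝ (Fin 2)) : ∑ i, (y i - line x c i) ^ 2 =
      ∑ i, y i ^ 2 - 2 * c 0 * ∑ i, y i - 2 * c 1 * ∑ i, (x i - mean x) * y i
        + n * c 0 ^ 2 + 2 * c 0 * c 1 * ∑ i, (x i - mean x)
        + c 1 ^ 2 * ∑ i, (x i - mean x) ^ 2 := by
    have hc : (n : ℝ) * c 0 ^ 2 = ∑ _i : Fin n, c 0 ^ 2 := by simp
    rw [hc]
    simp only [Finset.mul_sum, ← Finset.sum_add_distrib, ← Finset.sum_sub_distrib]
    refine Finset.sum_congr rfl fun i _ => ?_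
    simp only [line]
    ring
  rw [key, key, e0, e1, h0]
  ring

lemma likelihood_eq (x : Fin n → ℝ) (σ : ℝ) (β : EuclideanSpace ℝ (Fin 2)) (y : Fin n → ℝ) :
    likelihood x σ β y = (√(2 * Real.pi * σ ^ 2))⁻¹ ^ n *
      Real.exp (-(∑ i, (y i - line x β i) ^ 2) / (2 * σ ^ 2)) := by
  simp only [likelihood, density, gaussianPDFReal, coe_toNNReal_sq, Finset.prod_mul_distrib,
    Finset.prod_const, Finset.card_univ, Fintype.card_fin, ← Real.exp_sum, ← Finset.sum_div,
    Finset.sum_neg_distrib]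

lemma likelihood_le_iff {σ : ℝ} (hσ : 0 < σ) (x y : Fin n → ℝ)
    (β b : EuclideanSpace ℝ (Fin 2)) :
    likelihood x σ β y ≤ likelihood x σ b y ↔
      ∑ i, (y i - line x b i) ^ 2 ≤ ∑ i, (y i - line x β i) ^ 2 := by
  rw [likelihood_eq, likelihood_eq, mul_le_mul_iff_right₀ (by positivity), Real.exp_le_exp,
    div_le_div_iff_of_pos_right (by positivity), neg_le_neg_iff]

/-- Maximising the likelihood means minimising the residual sum of squares. The excess over least
squares has positive weights `n` and `∑ (x i - mean x) ^ 2`, which gives uniqueness. -/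
lemma isMLE_iff {σ : ℝ} (hσ : 0 < σ) {x : Fin n → ℝ} (hn : 0 < n)
    (hS : 0 < ∑ i, (x i - mean x) ^ 2) (y : Fin n → ℝ) (b : EuclideanSpace ℝ (Fin 2)) :
    IsMLE x σ y b ↔ b = leastSquares x y := by
  have hn' : (0 : ℝ) < n := by positivity
  simp only [IsMLE, likelihood_le_iff hσ]
  constructor
  · intro hb
    have h1 := hb (leastSquares x y)
    rw [sum_sq_sub_line hn hS] at h1
    have p0 := mul_nonneg hn'.le (sq_nonneg (b 0 - leastSquares x y 0))
    have p1 := mul_nonneg hS.le (sq_nonneg (b 1 - leastSquares x y 1))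
    have z0 : (n : ℝ) * (b 0 - leastSquares x y 0) ^ 2 = 0 := by linarith
    have z1 : (∑ i, (x i - mean x) ^ 2) * (b 1 - leastSquares x y 1) ^ 2 = 0 := by linarith
    ext k
    fin_cases k
    · simpa [hn'.ne', sub_eq_zero] using z0
    · simpa [hS.ne', sub_eq_zero] using z1
  · rintro rfl β
    rw [sum_sq_sub_line hn hS y β]
    have := hS.le
    exact le_add_of_nonneg_right (by positivity)

/-! ### The law of the normalized estimator -/

/-- The vector by which the `i`-th standardized error enters the normalized estimator. -/
noncomputable def errorCoeff (x : Fin n → ℝ) (i : Fin n) : EuclideanSpace ℝ (Fin 2) :=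
  !₂[1 / √n, (x i - mean x) / √(∑ j, (x j - mean x) ^ 2)]

/-- As `i` varies, the two coordinates of `errorCoeff x i` are orthonormal vectors of `ℝⁿ`; this is
the Parseval condition. -/
lemma sum_sq_inner_errorCoeff {x : Fin n → ℝ} (hn : 0 < n)
    (hS : 0 < ∑ i, (x i - mean x) ^ 2) (t : EuclideanSpace ℝ (Fin 2)) :
    ∑ i, inner ℝ (errorCoeff x i) t ^ 2 = ‖t‖ ^ 2 := by
  have hn' : (0 : ℝ) < n := by positivity
  have h0 := sum_sub_mean x
  set S := ∑ i, (x i - mean x) ^ 2 with hSdef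
  have hterm (i : Fin n) : inner ℝ (errorCoeff x i) t ^ 2 =
      t 0 ^ 2 / n + 2 * t 0 * t 1 / (√n * √S) * (x i - mean x)
        + t 1 ^ 2 / S * (x i - mean x) ^ 2 := by
    have hi : inner ℝ (errorCoeff x i) t = t 0 / √n + t 1 * (x i - mean x) / √S := by
      simp [errorCoeff, PiLp.inner_apply, ← hSdef]
      ring
    have q1 : t 0 ^ 2 / n = (t 0 / √n) ^ 2 := by rw [div_pow, Real.sq_sqrt hn'.le]
    have q2 : t 1 ^ 2 / S = (t 1 / √S) ^ 2 := by rw [div_pow, Real.sq_sqrt hS.le]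
    rw [hi, q1, q2]
    ring
  simp only [hterm, Finset.sum_add_distrib, ← Finset.mul_sum, h0, ← hSdef]
  rw [EuclideanSpace.real_norm_sq_eq]
  simp
  field_simp

lemma normalized_leastSquares {σ : ℝ} (hσ : 0 < σ) {x : Fin n → ℝ} (hn : 0 < n)
    (hS : 0 < ∑ i, (x i - mean x) ^ 2) (β : EuclideanSpace ℝ (Fin 2)) (y : Fin n → ℝ) :
    normalized x σ β (leastSquares x y) =
      ∑ i, ((y i - line x β i) / σ) • errorCoeff x i := by
  have hn' : (0 : ℝ) < n := by positivity
  have hσ' : σ ≠ 0 := hσ.ne'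
  have h0 := sum_sub_mean x
  have hl : ∑ i, line x β i = n * β 0 := by
    simp [line, Finset.sum_add_distrib, ← Finset.mul_sum, h0]
  have hl1 : ∑ i, (x i - mean x) * line x β i = (∑ i, (x i - mean x) ^ 2) * β 1 := by
    calc ∑ i, (x i - mean x) * line x β i
        = β 0 * ∑ i, (x i - mean x) + β 1 * ∑ i, (x i - mean x) ^ 2 := by
          simp only [Finset.mul_sum, ← Finset.sum_add_distrib]
          exact Finset.sum_congr rfl fun i _ => by simp only [line]; ring
      _ = _ := by rw [h0]; ring
  rw [normalized, sqrt_avgFisherInfo hσ hn]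
  ext k
  fin_cases k
  · have hsum : ∑ i, (y i - line x β i) / σ * (1 / √n) =
        (∑ i, y i - n * β 0) / (σ * √n) := by
      rw [← hl, ← Finset.sum_sub_distrib, Finset.sum_div]
      exact Finset.sum_congr rfl fun i _ => by rw [div_mul_div_comm, mul_one]
    have hL : (√(n : ℝ) • Matrix.toEuclideanLin (Matrix.diagonal
        ![1 / σ, √(∑ i, (x i - mean x) ^ 2) / (√n * σ)]) (leastSquares x y - β)) 0 =
        √n * (1 / σ * ((∑ i, y i) / n - β 0)) := by
      simp [Matrix.mulVec_diagonal, leastSquares, mul_sub]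
    have hR : (∑ i, ((y i - line x β i) / σ) • errorCoeff x i) 0 =
        ∑ i, (y i - line x β i) / σ * (1 / √n) := by
      simp [errorCoeff]
    refine hL.trans (Eq.trans ?_ hR.symm)
    rw [hsum]
    field_simp
    rw [Real.sq_sqrt hn'.le]
  · have hsum : ∑ i, (y i - line x β i) / σ * ((x i - mean x) / √(∑ j, (x j - mean x) ^ 2)) =
        (∑ i, (x i - mean x) * y i - (∑ i, (x i - mean x) ^ 2) * β 1) /
          (σ * √(∑ j, (x j - mean x) ^ 2)) := by
      rw [← hl1, ← Finset.sum_sub_distrib, Finset.sum_div]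
      exact Finset.sum_congr rfl fun i _ => by rw [div_mul_div_comm]; ring
    have hL : (√(n : ℝ) • Matrix.toEuclideanLin (Matrix.diagonal
        ![1 / σ, √(∑ i, (x i - mean x) ^ 2) / (√n * σ)]) (leastSquares x y - β)) 1 =
        √n * (√(∑ i, (x i - mean x) ^ 2) / (√n * σ) *
          ((∑ i, (x i - mean x) * y i) / (∑ i, (x i - mean x) ^ 2) - β 1)) := by
      simp [Matrix.mulVec_diagonal, leastSquares, mul_sub]
    have hR : (∑ i, ((y i - line x β i) / σ) • errorCoeff x i) 1 =
        ∑ i, (y i - line x β i) / σ * ((x i - mean x) / √(∑ j, (x j - mean x) ^ 2)) := by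
      simp [errorCoeff]
    refine hL.trans (Eq.trans ?_ hR.symm)
    rw [hsum]
    -- The sum becomes an atom, leaving an identity in `√S` and `S`.
    generalize ∑ i, (x i - mean x) ^ 2 = S at *
    field_simp
    rw [Real.sq_sqrt hS.le]

lemma hasLaw_standardized {Ω : Type*} [MeasurableSpace Ω] {P : Measure Ω} {x : Fin n → ℝ}
    {σ : ℝ} (hσ : 0 < σ) {β : EuclideanSpace ℝ (Fin 2)} {i : Fin n} {Y : Ω → ℝ}
    (hY : HasLaw Y (responseLaw x σ β i) P) :
    HasLaw (fun ω => (Y ω - line x β i) / σ) (gaussianReal 0 1) P := by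
  have h := gaussianReal_div_const (gaussianReal_sub_const hY (line x β i)) σ
  have hv : (σ ^ 2).toNNReal / NNReal.mk (σ ^ 2) (sq_nonneg σ) = 1 := by
    refine NNReal.eq ?_
    rw [NNReal.coe_div, coe_toNNReal_sq]
    exact div_self (pow_ne_zero 2 hσ.ne')
  simpa [hv] using h

lemma hasLaw_normalized_leastSquares {Ω : Type*} [MeasurableSpace Ω] {P : Measure Ω}
    [IsProbabilityMeasure P] {σ : ℝ} (hσ : 0 < σ) {x : Fin n → ℝ} (hn : 0 < n)
    (hS : 0 < ∑ i, (x i - mean x) ^ 2) {β : EuclideanSpace ℝ (Fin 2)} {Y : Fin n → Ω → ℝ}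
    (hY_indep : iIndepFun Y P) (hY_law : ∀ i, HasLaw (Y i) (responseLaw x σ β i) P) :
    HasLaw (fun ω => normalized x σ β (leastSquares x fun i => Y i ω))
      (multivariateGaussian 0 1) P := by
  rw [multivariateGaussian_zero_one]
  simp_rw [normalized_leastSquares hσ hn hS]
  exact hasLaw_stdGaussian_sum_smul (fun i => hasLaw_standardized hσ (hY_law i))
    (hY_indep.comp (fun i r => (r - line x β i) / σ) fun i => by fun_prop)
    (sum_sq_inner_errorCoeff hn hS)

end SimpleLinear

theorem mainTheorem6 {Ω Ω' : Type*} [MeasurableSpace Ω] [MeasurableSpace Ω']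
    (P : Measure Ω) [IsProbabilityMeasure P] (Q : Measure Ω') [IsProbabilityMeasure Q]
    (n : ℕ) (x : Fin n → ℝ) (hx : ∃ i j, x i ≠ x j)
    (σ : ℝ) (hσ : 0 < σ) (β₀ : EuclideanSpace ℝ (Fin 2))
    (Y : Fin n → Ω → ℝ) (hY_indep : iIndepFun Y P)
    (hY_law : ∀ i, HasLaw (Y i) (responseLaw x σ β₀ i) P)
    (Z : Ω' → EuclideanSpace ℝ (Fin 2)) (hZ : HasLaw Z (multivariateGaussian 0 1) Q)
    (h : EuclideanSpace ℝ (Fin 2) → ℝ) (hh : IsTestFunction h) :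
    (∀ (y : Fin n → ℝ) (b : EuclideanSpace ℝ (Fin 2)), IsMLE x σ y b ↔
      b = !₂[(∑ i, y i) / n, (∑ i, (x i - mean x) * y i) / ∑ i, (x i - mean x) ^ 2]) ∧
    ∀ βhat : Ω → EuclideanSpace ℝ (Fin 2), (∀ ω, IsMLE x σ (fun i => Y i ω) (βhat ω)) →
      Integrable (fun ω => h (normalized x σ β₀ (βhat ω))) P ∧
      Integrable (fun ω => h (Z ω)) Q ∧
      |(∫ ω, h (normalized x σ β₀ (βhat ω)) ∂P) - ∫ ω, h (Z ω) ∂Q| ≤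
        derivNorm₂ h / 4 *
            (√(2 / n) + √(2 * ∑ i, (x i - mean x) ^ 4) / ∑ i, (x i - mean x) ^ 2)
          + derivNorm₂ h / √(2 * n)
          + 8 * derivNorm₃ h / (3 * √Real.pi) *
            (1 / √n + (∑ i, |x i - mean x| ^ 3) / (∑ i, (x i - mean x) ^ 2) ^ (3 / 2 : ℝ)) := by
  -- An index with `x i ≠ x j` already forces `Fin n` to be nonempty.
  have hn : 0 < n := hx.elim fun i _ => i.pos
  have hS := sum_sq_sub_mean_pos hx
  refine ⟨isMLE_iff hσ hn hS, fun βhat hβ => ?_⟩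
  have hb : βhat = fun ω => leastSquares x fun i => Y i ω :=
    funext fun ω => (isMLE_iff hσ hn hS _ _).1 (hβ ω)
  subst hb
  have hW := hasLaw_normalized_leastSquares hσ hn hS hY_indep hY_law
  have hint := hh.integrable (multivariateGaussian 0 1)
  have hm := hh.differentiable₁.continuous.aestronglyMeasurable
    (μ := multivariateGaussian (0 : EuclideanSpace ℝ (Fin 2)) 1)
  refine ⟨?_, ?_, ?_⟩
  · rw [← hW.map_eq] at hint
    exact hint.comp_aemeasurable hW.aemeasurable
  · rw [← hZ.map_eq] at hint
    exact hint.comp_aemeasurable hZ.aemeasurable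
  · have h1 := hW.integral_comp hm
    have h2 := hZ.integral_comp hm
    simp only [Function.comp_def] at h1 h2
    -- Both expectations are the integral of `h` against the same Gaussian measure.
    rw [h1, h2, sub_self, abs_zero]
    have := derivNorm₂_nonneg h
    have := derivNorm₃_nonneg h
    have := hS.le
    positivity
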